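/- Let $W=\{w_1,\dots,w_n\}$ (women) and $M=\{m_1,\dots,m_n\}$ (men) be disjoint. A preference list over $M$ (resp. $W$) is a totally ordered subset of $M$ (resp. $W$), read from best to worst; whoever is absent from it is unacceptable. A participant prefers $a$ over $b$ if $a$ precedes $b$ on the participant's list or if $a$ is on the list and $b$ is not, and prefers $a$ over being single iff $a$ is on the list. Let $\mathcal P_W$ be given by a preference list over $M$ for each woman, and $\mathcal P_M$ by a preference list over $W$ for each man. A marriage is a one-to-one mapping between a subset of $W$ and a subset of $M$; it is stable if nobody is married to an unacceptable partner and there is no pair $(w,m)\in W\times M$ in which each prefers the other over their present situation (spouse, or being single). (i) For all $n$, all $p\in W\cup M$ and all $\mathcal P_W,\mathcal P_M$: $p$ is single in some stable marriage if and only if $p$ is single in every stable marriage. (ii) For every fixed $q$ with $\tfrac12<q\le 1$ (for instance $q=\tfrac23$) there are $c>0$ and $N$ such that for all $n\ge N$ and every fixed $p\in W\cup M$ the following holds for the problem of deciding, given $(\mathcal P_W,\mathcal P_M)$, whether $p$ is single in some stable marriage, and likewise for the problem of deciding whether $p$ is single in every stable marriage. (a) Every two-party communication protocol, with Alice holding $\mathcal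 P_W$ and Bob holding $\mathcal P_M$, that is deterministic, or that is randomized (with shared or private coins) and for every fixed input outputs the correct answer with probability at least $q$, exchanges at least $cn^2$ bits in the worst case. (b) Every adaptive algorithm that accesses its input only through Boolean queries, where each query may be an arbitrary Boolean function of $\mathcal P_W$ or an arbitrary Boolean function of $\mathcal P_M$, and that is deterministic, or that is randomized and for every fixed input outputs the correct answer with probability at least $q$, makes at least $cn^2$ queries in the worst case. -/

import Mathlib

open scoped ENNReal

/-! ### Stable marriages with possibly incomplete preference lists -/

/-- A (not necessarily full) preference list over `B`: a totally ordered subset of `B`, written as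
a repetition-free list from best to worst. Elements that are absent are unacceptable. -/
def PrefList (B : Type*) : Type _ := {l : List B // l.Nodup}

/-- The entry `b` appears on the list, i.e. `b` is acceptable. -/
def PrefList.Accepts {B : Type*} (L : PrefList B) (b : B) : Prop := b ∈ L.1

/-- `b` is preferred over `b'`: either `b` precedes `b'` on the list, or `b` is on the list
while `b'` is not. -/
def PrefList.Prefers {B : Type*} (L : PrefList B) (b b' : B) : Prop :=
  [b, b'].Sublist L.1 ∨ (L.Accepts b ∧ ¬ L.Accepts b')

/-- `b` is preferred over the present marital situation, where `none` stands for being single;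
exactly the acceptable partners are preferred over being single. -/
def PrefList.PrefersToSpouse {B : Type*} (L : PrefList B) (b : B) : Option B → Prop
  | none => L.Accepts b
  | some b' => L.Prefers b b'

/-- A profile of preference lists for `A` over `B`. -/
abbrev Profile (A B : Type*) : Type _ := A → PrefList B

/-- A (not necessarily perfect) marriage: a one-to-one mapping between a subset of `W` and a
subset of `M`. -/
abbrev Marriage (W M : Type*) : Type _ := W ≃. M

/-- `(w, m)` blocks `μ`: each of the two prefers the other over their spouse in `μ`. -/
def IsBlockingPair {W M : Type*} (PW : Profile W M) (PM : Profile M W) (μ : Marriage W M)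
    (w : W) (m : M) : Prop :=
  (PW w).PrefersToSpouse m (μ w) ∧ (PM m).PrefersToSpouse w (μ.symm m)

/-- A marriage is stable if nobody is married to somebody outside their own preference list and
there is no blocking pair. -/
structure IsStable {W M : Type*} (PW : Profile W M) (PM : Profile M W) (μ : Marriage W M) :
    Prop where
  woman_accepts : ∀ w m, μ w = some m → (PW w).Accepts m
  man_accepts : ∀ w m, μ w = some m → (PM m).Accepts w
  no_blocking : ∀ w m, ¬ IsBlockingPair PW PM μ w m

/-- The participant `p` (a woman or a man) is single in `μ`. -/
def IsSingle {W M : Type*} (μ : Marriage W M) : W ⊕ M → Prop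
  | Sum.inl w => μ w = none
  | Sum.inr m => μ.symm m = none

/-- `p` is single in some stable marriage. -/
def SingleInSome {W M : Type*} (p : W ⊕ M) (PW : Profile W M) (PM : Profile M W) : Prop :=
  ∃ μ : Marriage W M, IsStable PW PM μ ∧ IsSingle μ p

/-- `p` is single in every stable marriage. -/
def SingleInEvery {W M : Type*} (p : W ⊕ M) (PW : Profile W M) (PM : Profile M W) : Prop :=
  ∀ μ : Marriage W M, IsStable PW PM μ → IsSingle μ p

open Classical in
/-- The Boolean function on inputs `(x, y)` that decides the relation `R`. -/
noncomputable def decisionProblem {α β : Type*} (R : α → β → Prop) (x : α) (y : β) : Bool :=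
  decide (R x y)

/-! ### Two-party communication -/

/-- A deterministic two-party protocol tree with Boolean output. Alice holds `x : α`, Bob holds
`y : β`. At an inner node, its owner announces one bit that depends on the owner's input, and the
protocol moves on accordingly (so the messages depend on the earlier transcript). -/
inductive Protocol (α β : Type*) : Type _
  | output (b : Bool) : Protocol α β
  | alice (msg : α → Bool) (next : Bool → Protocol α β) : Protocol α β
  | bob (msg : β → Bool) (next : Bool → Protocol α β) : Protocol α β

namespace Protocol

/-- The output on the inputs `x`, `y`. -/
def run {α β : Type*} : Protocol α β → α → β → Bool
  | output b, _, _ => b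
  | alice msg next, x, y => (next (msg x)).run x y
  | bob msg next, x, y => (next (msg y)).run x y

/-- The number of bits exchanged on the inputs `x`, `y`. -/
def bits {α β : Type*} : Protocol α β → α → β → ℕ
  | output _, _, _ => 0
  | alice msg next, x, y => (next (msg x)).bits x y + 1
  | bob msg next, x, y => (next (msg y)).bits x y + 1

end Protocol

/-! ### Boolean queries -/

/-- A deterministic adaptive algorithm that accesses its inputs `x : α` and `y : β` only through
Boolean queries. Any Boolean function of `x` and any Boolean function of `y` may be queried. -/
inductive QueryAlgorithm (α β : Type*) : Type _
  | output (b : Bool) : QueryAlgorithm α β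
  | ask (query : (α → Bool) ⊕ (β → Bool)) (next : Bool → QueryAlgorithm α β) : QueryAlgorithm α β

namespace QueryAlgorithm

/-- The answer to a query on the inputs `x`, `y`. -/
def answer {α β : Type*} (query : (α → Bool) ⊕ (β → Bool)) (x : α) (y : β) : Bool :=
  query.elim (fun g => g x) (fun g => g y)

/-- The output on the inputs `x`, `y`. -/
def run {α β : Type*} : QueryAlgorithm α β → α → β → Bool
  | output b, _, _ => b
  | ask query next, x, y => (next (answer query x y)).run x y

/-- The number of queries performed on the inputs `x`, `y`. -/
def queries {α β : Type*} : QueryAlgorithm α β → α → β → ℕ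
  | output _, _, _ => 0
  | ask query next, x, y => (next (answer query x y)).queries x y + 1

end QueryAlgorithm

/-! ### Worst-case complexity, deterministic and randomized -/

/-- The least worst-case cost of a procedure in the class `S` that computes `f` (`⊤` if there is
none). -/
noncomputable def deterministicComplexity {S α β : Type*} (run : S → α → β → Bool)
    (cost : S → α → β → ℕ) (f : α → β → Bool) : ℕ∞ :=
  ⨅ (s : S) (_ : ∀ x y, run s x y = f x y), ⨆ (x : α) (y : β), (cost s x y : ℕ∞)

/-- The least worst-case cost of a randomized procedure that, on every fixed input, outputs
the value of `f` with probability at least `q` (`⊤` if there is none). A randomized procedure is a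
probability distribution over deterministic ones: all coins are tossed in advance, and in the
two-party setting both parties see them (in particular, private coins are allowed). The worst case
is taken over the inputs and over the coin tosses. -/
noncomputable def randomizedComplexity {S α β : Type*} (run : S → α → β → Bool)
    (cost : S → α → β → ℕ) (q : ℝ) (f : α → β → Bool) : ℕ∞ :=
  ⨅ (P : PMF S) (_ : ∀ x y, ENNReal.ofReal q ≤ (P.map fun s => run s x y) (f x y)),
    ⨆ s ∈ P.support, ⨆ (x : α) (y : β), (cost s x y : ℕ∞)

/-- Deterministic communication complexity of `f`. -/
noncomputable def communicationComplexity {α β : Type*} (f : α → β → Bool) : ℕ∞ :=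
  deterministicComplexity Protocol.run Protocol.bits f

/-- Randomized communication complexity of `f` with success probability `q`. -/
noncomputable def randomizedCommunicationComplexity {α β : Type*} (q : ℝ)
    (f : α → β → Bool) : ℕ∞ :=
  randomizedComplexity Protocol.run Protocol.bits q f

/-- Deterministic Boolean query complexity of `f`. -/
noncomputable def queryComplexity {α β : Type*} (f : α → β → Bool) : ℕ∞ :=
  deterministicComplexity QueryAlgorithm.run QueryAlgorithm.queries f

/-- Randomized Boolean query complexity of `f` with success probability `q`. -/
noncomputable def randomizedQueryComplexity {α β : Type*} (q : ℝ) (f : α → β → Bool) : ℕ∞ :=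
  randomizedComplexity QueryAlgorithm.run QueryAlgorithm.queries q f

/-! ### Ranks -/

namespace PrefList

open Classical in
/-- The position of an entry on a preference list; absent entries get the length of the list. -/
noncomputable def rank {B : Type*} (L : PrefList B) (b : B) : ℕ := L.1.idxOf b

/-- The rank of a marital situation; being single gets the length of the list. -/
noncomputable def spouseRank {B : Type*} (L : PrefList B) : Option B → ℕ
  | none => L.1.length
  | some b => L.rank b

theorem accepts_iff_rank_lt {B : Type*} (L : PrefList B) (b : B) :
    L.Accepts b ↔ L.rank b < L.1.length := by
  classical
  exact List.idxOf_lt_length_iff.symm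

theorem rank_le_length {B : Type*} (L : PrefList B) (b : B) : L.rank b ≤ L.1.length := by
  classical
  exact List.idxOf_le_length

theorem eq_of_rank_eq {B : Type*} (L : PrefList B) {b b' : B} (hb : L.Accepts b)
    (h : L.rank b = L.rank b') : b = b' := by
  classical
  exact (List.idxOf_inj hb).1 h

theorem sublist_pair_iff {B : Type*} (L : PrefList B) (b b' : B) :
    [b, b'].Sublist L.1 ↔ L.rank b < L.rank b' ∧ L.Accepts b' := by
  classical
  obtain ⟨l, hl⟩ := L
  simp only [rank, Accepts]
  induction l with
  | nil => simp
  | cons a l ih =>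
    have ih := ih hl.of_cons
    have ha : a ∉ l := (List.nodup_cons.1 hl).1
    by_cases hab : a = b
    · subst hab
      by_cases hab' : a = b'
      · subst hab'
        simp [ha]
      · simp [List.idxOf_cons_ne _ hab', Ne.symm hab']
    · have hsub : [b, b'].Sublist (a :: l) ↔ [b, b'].Sublist l := by
        rw [List.sublist_cons_iff]
        simp [Ne.symm hab]
      rw [hsub, ih, List.idxOf_cons_ne _ hab]
      by_cases hab' : a = b'
      · subst hab'
        simp [ha]
      · simp [List.idxOf_cons_ne _ hab', Ne.symm hab']

theorem prefers_iff_rank_lt {B : Type*} (L : PrefList B) (b b' : B) :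
    L.Prefers b b' ↔ L.rank b < L.rank b' := by
  have h1 := L.accepts_iff_rank_lt b
  have h2 := L.accepts_iff_rank_lt b'
  have h3 := L.rank_le_length b
  have h4 := L.rank_le_length b'
  rw [Prefers, sublist_pair_iff, h1, h2]
  omega

theorem prefersToSpouse_iff {B : Type*} (L : PrefList B) (b : B) (s : Option B) :
    L.PrefersToSpouse b s ↔ L.rank b < L.spouseRank s := by
  cases s with
  | none => exact L.accepts_iff_rank_lt b
  | some b' => exact L.prefers_iff_rank_lt b b'

end PrefList

/-! ### Stable marriages -/

section Stable

variable {W M : Type*} {PW : Profile W M} {PM : Profile M W}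

theorem IsStable.symm {μ : Marriage W M} (h : IsStable PW PM μ) : IsStable PM PW μ.symm where
  woman_accepts m w hm := h.man_accepts w m ((PEquiv.eq_some_iff μ).1 hm)
  man_accepts m w hm := h.woman_accepts w m ((PEquiv.eq_some_iff μ).1 hm)
  no_blocking m w hb := h.no_blocking w m ⟨hb.2, hb.1⟩

theorem isSingle_symm (μ : Marriage W M) (p : W ⊕ M) : IsSingle μ.symm p.swap ↔ IsSingle μ p := by
  cases p <;> rfl

theorem singleInSome_swap (p : W ⊕ M) :
    SingleInSome p.swap PM PW ↔ SingleInSome p PW PM := by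
  constructor
  · rintro ⟨μ, hμ, hs⟩
    refine ⟨μ.symm, hμ.symm, ?_⟩
    have := (isSingle_symm μ p.swap).2 hs
    rwa [Sum.swap_swap] at this
  · rintro ⟨μ, hμ, hs⟩
    exact ⟨μ.symm, hμ.symm, (isSingle_symm μ p).2 hs⟩

theorem IsStable.not_rank_lt {μ : Marriage W M} (h : IsStable PW PM μ) (w : W) (m : M)
    (hw : (PW w).rank m < (PW w).spouseRank (μ w)) :
    (PM m).spouseRank (μ.symm m) ≤ (PM m).rank w := by
  by_contra hm
  exact h.no_blocking w m ⟨((PW w).prefersToSpouse_iff _ _).2 hw,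
    ((PM m).prefersToSpouse_iff _ _).2 (not_le.1 hm)⟩

/-- If a woman is better off in `ν` than in `μ`, then the husband from `ν` is married in `μ`, and
to a woman who is better off in `ν` as well. -/
theorem IsStable.exists_better_off {μ ν : Marriage W M} (hμ : IsStable PW PM μ)
    (hν : IsStable PW PM ν) {w : W}
    (hw : (PW w).spouseRank (ν w) < (PW w).spouseRank (μ w)) :
    ∃ w' m, ν w = some m ∧ μ w' = some m ∧
      (PW w').spouseRank (ν w') < (PW w').spouseRank (μ w') := by
  obtain ⟨m, hm⟩ : ∃ m, ν w = some m := by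
    rcases hs : ν w with _ | m
    · rw [hs] at hw
      rcases hs' : μ w with _ | m
      · rw [hs'] at hw
        exact absurd hw (lt_irrefl _)
      · rw [hs'] at hw
        exact absurd hw (not_lt.2 ((PW w).rank_le_length m))
    · exact ⟨m, rfl⟩
  rw [hm] at hw
  have h1 := hμ.not_rank_lt w m hw
  have hacc := hν.man_accepts w m hm
  have hνm : ν.symm m = some w := (PEquiv.eq_some_iff ν).2 hm
  rcases hs : μ.symm m with _ | w'
  · rw [hs] at h1
    exact absurd (((PM m).accepts_iff_rank_lt w).1 hacc) (not_lt.2 h1)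
  · have hw' : μ w' = some m := (PEquiv.eq_some_iff μ).1 hs
    refine ⟨w', m, hm, hw', ?_⟩
    rw [hs] at h1
    change (PM m).rank w' ≤ (PM m).rank w at h1
    have hne : w' ≠ w := by
      rintro rfl
      rw [hw'] at hw
      exact absurd hw (lt_irrefl _)
    have hlt : (PM m).rank w' < (PM m).rank w := lt_of_le_of_ne h1 fun h =>
      hne ((PM m).eq_of_rank_eq (hμ.man_accepts w' m hw') h)
    have h2 := hν.symm.not_rank_lt m w' (by rw [hνm]; exact hlt)
    rw [PEquiv.symm_symm] at h2
    rw [hw']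
    refine lt_of_le_of_ne h2 fun h => ?_
    rcases hs' : ν w' with _ | m'
    · rw [hs'] at h
      have := ((PW w').accepts_iff_rank_lt m).1 (hμ.woman_accepts w' m hw')
      exact absurd h this.ne'
    · rw [hs'] at h
      have hmm : m' = m := (PW w').eq_of_rank_eq (hν.woman_accepts w' m' hs') h
      subst hmm
      exact hne (ν.inj hs' hm)

theorem IsStable.isSingle_woman [Finite W] {μ ν : Marriage W M} (hμ : IsStable PW PM μ)
    (hν : IsStable PW PM ν) {w : W} (hw : μ w = none) : ν w = none := by
  by_contra hne
  obtain ⟨m, hm⟩ := Option.ne_none_iff_exists'.1 hne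
  let S := {w : W // (PW w).spouseRank (ν w) < (PW w).spouseRank (μ w)}
  choose g mm hν' hμ' hS using fun s : S => hμ.exists_better_off hν s.2
  let G : S → S := fun s => ⟨g s, hS s⟩
  have hG : Function.Injective G := by
    intro s t hst
    have hst : g s = g t := congrArg Subtype.val hst
    have h1 := hμ' s
    rw [hst, hμ' t] at h1
    have h2 := hν' t
    rw [Option.some.inj h1] at h2
    exact Subtype.ext (ν.inj (hν' s) h2)
  have hwS : (PW w).spouseRank (ν w) < (PW w).spouseRank (μ w) := by
    rw [hw, hm]
    exact ((PW w).accepts_iff_rank_lt m).1 (hν.woman_accepts w m hm)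
  obtain ⟨s, hs⟩ := Finite.surjective_of_injective hG ⟨w, hwS⟩
  have h1 : g s = w := congrArg Subtype.val hs
  have h2 := hμ' s
  rw [h1, hw] at h2
  exact absurd h2 (by simp)

/-- The set of singles is the same in all stable marriages. -/
theorem IsStable.isSingle_of_isSingle [Finite W] [Finite M] {μ ν : Marriage W M}
    (hμ : IsStable PW PM μ) (hν : IsStable PW PM ν) {p : W ⊕ M} (hp : IsSingle μ p) :
    IsSingle ν p := by
  cases p with
  | inl w => exact hμ.isSingle_woman hν hp
  | inr m => exact hμ.symm.isSingle_woman hν.symm hp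

/-! ### Existence -/

/-- A relation that is functional in both directions, as a partial equivalence. -/
theorem PEquiv.exists_of_rel (Q : W → M → Prop) (h1 : ∀ w m m', Q w m → Q w m' → m = m')
    (h2 : ∀ w w' m, Q w m → Q w' m → w = w') :
    ∃ μ : W ≃. M, ∀ w m, μ w = some m ↔ Q w m := by
  classical
  have key1 : ∀ w m, (if h : ∃ m, Q w m then some h.choose else none) = some m ↔ Q w m := by
    intro w m
    by_cases h : ∃ m, Q w m
    · rw [dif_pos h, Option.some_inj]
      exact ⟨fun e => e ▸ h.choose_spec, fun e => h1 _ _ _ h.choose_spec e⟩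
    · rw [dif_neg h]
      exact ⟨fun e => absurd e (by simp), fun e => absurd ⟨m, e⟩ h⟩
  have key2 : ∀ w m, (if h : ∃ w, Q w m then some h.choose else none) = some w ↔ Q w m := by
    intro w m
    by_cases h : ∃ w, Q w m
    · rw [dif_pos h, Option.some_inj]
      exact ⟨fun e => e ▸ h.choose_spec, fun e => h2 _ _ _ h.choose_spec e⟩
    · rw [dif_neg h]
      exact ⟨fun e => absurd e (by simp), fun e => absurd ⟨w, e⟩ h⟩
  exact ⟨⟨fun w => if h : ∃ m, Q w m then some h.choose else none,
    fun m => if h : ∃ w, Q w m then some h.choose else none,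
    fun w m => (key2 w m).trans (key1 w m).symm⟩, key1⟩

/-- The proposals in `X` that are worse, for the woman, than another proposal in `X`. -/
def rejectedByWomen (PW : Profile W M) (X : Set (W × M)) : Set (W × M) :=
  {a | a ∈ X ∧ ∃ m, (a.1, m) ∈ X ∧ (PW a.1).rank m < (PW a.1).rank a.2}

/-- The proposals in `X` that are worse, for the man, than another proposal in `X`. -/
def rejectedByMen (PM : Profile M W) (X : Set (W × M)) : Set (W × M) :=
  {a | a ∈ X ∧ ∃ w, (w, a.2) ∈ X ∧ (PM a.2).rank w < (PM a.2).rank a.1}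

theorem rejectedByWomen_mono (PW : Profile W M) : Monotone (rejectedByWomen PW) :=
  fun _ _ h _ ⟨h1, m, h2, h3⟩ => ⟨h h1, m, h h2, h3⟩

theorem rejectedByMen_mono (PM : Profile M W) : Monotone (rejectedByMen PM) :=
  fun _ _ h _ ⟨h1, w, h2, h3⟩ => ⟨h h1, w, h h2, h3⟩

theorem exists_isStable (PW : Profile W M) (PM : Profile M W) :
    ∃ μ : Marriage W M, IsStable PW PM μ := by
  let E : Set (W × M) := {a | (PW a.1).Accepts a.2 ∧ (PM a.2).Accepts a.1}
  let F : Set (W × M) →o Set (W × M) :=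
    ⟨fun X => E \ rejectedByWomen PW (E \ rejectedByMen PM X), fun X X' h =>
      Set.sdiff_subset_sdiff_right (rejectedByWomen_mono PW
        (Set.sdiff_subset_sdiff_right (rejectedByMen_mono PM h)))⟩
  set X := F.lfp with hX
  set Y := E \ rejectedByMen PM X with hY
  have hXY : X = E \ rejectedByWomen PW Y := (F.map_lfp).symm
  have hXE : X ⊆ E := by rw [hXY]; exact Set.sdiff_subset
  have hYE : Y ⊆ E := Set.sdiff_subset
  have memX : ∀ a ∈ E, a ∈ X ↔ a ∉ rejectedByWomen PW Y := fun a ha => by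
    conv_lhs => rw [hXY]
    exact ⟨fun h => h.2, fun h => ⟨ha, h⟩⟩
  have memY : ∀ a ∈ E, a ∈ Y ↔ a ∉ rejectedByMen PM X := fun a ha =>
    ⟨fun h => h.2, fun h => ⟨ha, h⟩⟩
  obtain ⟨μ, hμ⟩ := PEquiv.exists_of_rel (fun w m => (w, m) ∈ X ∧ (w, m) ∈ Y)
    (by
      rintro w m m' ⟨hx, hy⟩ ⟨hx', hy'⟩
      have n1 := (memX _ (hXE hx)).1 hx
      have n2 := (memX _ (hXE hx')).1 hx'
      refine (PW w).eq_of_rank_eq (hXE hx).1 (le_antisymm ?_ ?_)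
      · exact not_lt.1 fun h => n1 ⟨hy, m', hy', h⟩
      · exact not_lt.1 fun h => n2 ⟨hy', m, hy, h⟩)
    (by
      rintro w w' m ⟨hx, hy⟩ ⟨hx', hy'⟩
      have n1 := (memY _ (hXE hx)).1 hy
      have n2 := (memY _ (hXE hx')).1 hy'
      refine (PM m).eq_of_rank_eq (hXE hx).2 (le_antisymm ?_ ?_)
      · exact not_lt.1 fun h => n1 ⟨hx, w', hx', h⟩
      · exact not_lt.1 fun h => n2 ⟨hx', w, hx, h⟩)
  refine ⟨μ, fun w m h => (hXE ((hμ w m).1 h).1).1, fun w m h => (hXE ((hμ w m).1 h).1).2, ?_⟩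
  rintro w m ⟨hbw, hbm⟩
  rw [PrefList.prefersToSpouse_iff] at hbw hbm
  have hE : (w, m) ∈ E := by
    refine ⟨((PW w).accepts_iff_rank_lt m).2 (hbw.trans_le ?_),
      ((PM m).accepts_iff_rank_lt w).2 (hbm.trans_le ?_)⟩
    · rcases μ w with _ | m'
      exacts [le_rfl, (PW w).rank_le_length m']
    · rcases μ.symm m with _ | w'
      exacts [le_rfl, (PM m).rank_le_length w']
  by_cases hy : (w, m) ∈ Y
  · have hne : {m' | (w, m') ∈ Y}.Nonempty := ⟨m, hy⟩
    let m₀ := Function.argminOn (PW w).rank {m' | (w, m') ∈ Y} hne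
    have h0 : (w, m₀) ∈ Y := Function.argminOn_mem (PW w).rank {m' | (w, m') ∈ Y} hne
    have hmin : ∀ m', (w, m') ∈ Y → (PW w).rank m₀ ≤ (PW w).rank m' := fun m' h' =>
      Function.argminOn_le (PW w).rank {m' | (w, m') ∈ Y} h'
    have hx0 : (w, m₀) ∈ X := (memX _ (hYE h0)).2 fun ⟨_, m', h', hlt⟩ =>
      absurd hlt (not_lt.2 (hmin m' h'))
    rw [(hμ w m₀).2 ⟨hx0, h0⟩] at hbw
    exact absurd hbw (not_lt.2 (hmin m hy))
  · have hx : (w, m) ∈ X := by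
      have := mt (memY _ hE).2 hy
      exact (not_not.1 this).1
    have hne : {w' | (w', m) ∈ X}.Nonempty := ⟨w, hx⟩
    let w₀ := Function.argminOn (PM m).rank {w' | (w', m) ∈ X} hne
    have h0 : (w₀, m) ∈ X := Function.argminOn_mem (PM m).rank {w' | (w', m) ∈ X} hne
    have hmin : ∀ w', (w', m) ∈ X → (PM m).rank w₀ ≤ (PM m).rank w' := fun w' h' =>
      Function.argminOn_le (PM m).rank {w' | (w', m) ∈ X} h'
    have hy0 : (w₀, m) ∈ Y := (memY _ (hXE h0)).2 fun ⟨_, w', h', hlt⟩ =>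
      absurd hlt (not_lt.2 (hmin w' h'))
    rw [(PEquiv.eq_some_iff μ).2 ((hμ w₀ m).2 ⟨h0, hy0⟩)] at hbm
    exact absurd hbm (not_lt.2 (hmin w hx))

theorem singleInSome_iff_singleInEvery [Finite W] [Finite M] (p : W ⊕ M) (PW : Profile W M)
    (PM : Profile M W) : SingleInSome p PW PM ↔ SingleInEvery p PW PM := by
  constructor
  · rintro ⟨μ, hμ, hs⟩ ν hν
    exact hμ.isSingle_of_isSingle hν hs
  · intro h
    obtain ⟨μ, hμ⟩ := exists_isStable PW PM
    exact ⟨μ, hμ, h μ hμ⟩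

end Stable

/-! ### Averages over the cube -/

section Corruption

open Finset
open scoped BigOperators

theorem update_true_and_update {ι : Type*} [DecidableEq ι] (d u : ι → Bool) (i : ι)
    (b : Bool) :
    (fun j => Function.update d i true j && Function.update u i b j)
      = Function.update (fun j => d j && u j) i b := by
  funext j
  by_cases h : j = i
  · subst h; simp
  · simp [h]

theorem update_false_and {ι : Type*} [DecidableEq ι] (d u : ι → Bool) (i : ι) :
    (fun j => Function.update d i false j && u j)
      = Function.update (fun j => d j && u j) i false := by
  funext j
  by_cases h : j = i
  · subst h; simp
  · simp [h]

theorem not_update {ι : Type*} [DecidableEq ι] (d : ι → Bool) (i : ι) (b : Bool) :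
    (fun j => !(Function.update d i b j)) = Function.update (fun j => !d j) i (!b) := by
  funext j
  by_cases h : j = i
  · subst h; simp
  · simp [h]

variable {ι : Type*} [Fintype ι] [DecidableEq ι]

theorem expect_update (i : ι) (Φ : (ι → Bool) → ℝ) :
    𝔼 d, Φ d = 𝔼 d, (Φ (Function.update d i false) + Φ (Function.update d i true)) / 2 := by
  have hinv : Function.Involutive fun d : ι → Bool => Function.update d i (!d i) := by
    intro d
    simp
  have h : 𝔼 d, Φ d = 𝔼 d, Φ (Function.update d i (!d i)) :=
    Fintype.expect_equiv hinv.toPerm _ _ fun d => by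
      simp [Function.Involutive.coe_toPerm]
  have h2 : ∀ d : ι → Bool, Φ (Function.update d i false) + Φ (Function.update d i true)
      = Φ d + Φ (Function.update d i (!d i)) := by
    intro d
    have hd : Φ (Function.update d i (d i)) = Φ d := by rw [Function.update_eq_self]
    rw [← hd]
    cases d i <;> simp [add_comm]
  simp_rw [h2]
  rw [← Finset.expect_div, Finset.expect_add_distrib, ← h]
  ring

/-- The sign of a bit. -/
def bitSign (b : Bool) : ℝ := if b then -1 else 1

/-- The level-1 inequality. -/
theorem level_one (H : (ι → Bool) → ℝ) (h0 : ∀ u, 0 ≤ H u) (h1 : ∀ u, H u ≤ 1) :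
    ∑ i, (𝔼 u : ι → Bool, H u * bitSign (u i)) ^ 2 / (𝔼 u, H u)
      ≤ 2 * ((𝔼 u, H u) * -Real.log (𝔼 u, H u)) := by
  set m := 𝔼 u, H u with hm
  have hm0 : 0 ≤ m := Finset.expect_nonneg fun u _ => h0 u
  rcases hm0.eq_or_lt with hz | hpos
  · rw [← hz]
    simp
  set c : ι → ℝ := fun i => (𝔼 u : ι → Bool, H u * bitSign (u i)) / m with hc
  set w := ∑ i, c i ^ 2 with hw
  have hci : ∀ i, 𝔼 u : ι → Bool, H u * bitSign (u i) = m * c i := fun i => by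
    simp only [hc]
    field_simp
  have hT : 𝔼 u : ι → Bool, H u * ∑ i, c i * bitSign (u i) = m * w := by
    calc 𝔼 u : ι → Bool, H u * ∑ i, c i * bitSign (u i)
        = 𝔼 u : ι → Bool, ∑ i, c i * (H u * bitSign (u i)) := by
          refine Finset.expect_congr rfl fun u _ => ?_
          rw [Finset.mul_sum]
          exact Finset.sum_congr rfl fun i _ => by ring
      _ = ∑ i, c i * (m * c i) := by
          rw [Finset.expect_sum_comm]
          refine Finset.sum_congr rfl fun i _ => ?_
          rw [← Finset.mul_expect, hci]
      _ = m * w := by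
          rw [hw, Finset.mul_sum]
          exact Finset.sum_congr rfl fun i _ => by ring
  have hlow : m * Real.exp w ≤ 𝔼 u : ι → Bool, Real.exp (∑ i, c i * bitSign (u i)) := by
    calc m * Real.exp w = 𝔼 u : ι → Bool, (Real.exp w * (H u * ∑ i, c i * bitSign (u i))
            + Real.exp w * (1 - w) * H u) := by
          rw [Finset.expect_add_distrib, ← Finset.mul_expect, ← Finset.mul_expect, hT, ← hm]
          ring
      _ ≤ _ := by
          refine Finset.expect_le_expect fun u _ => ?_
          set t := ∑ i, c i * bitSign (u i)
          have h3 : Real.exp w * (1 + t - w) ≤ Real.exp t := by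
            have := Real.add_one_le_exp (t - w)
            have h4 : Real.exp t = Real.exp w * Real.exp (t - w) := by
              rw [← Real.exp_add]; congr 1; ring
            rw [h4]
            exact mul_le_mul_of_nonneg_left (by linarith) (Real.exp_pos _).le
          calc _ = H u * (Real.exp w * (1 + t - w)) := by ring
            _ ≤ H u * Real.exp t := mul_le_mul_of_nonneg_left h3 (h0 u)
            _ ≤ 1 * Real.exp t := mul_le_mul_of_nonneg_right (h1 u) (Real.exp_pos _).le
            _ = _ := one_mul _
  have hup : 𝔼 u : ι → Bool, Real.exp (∑ i, c i * bitSign (u i)) ≤ Real.exp (w / 2) := by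
    have hprod : 𝔼 u : ι → Bool, Real.exp (∑ i, c i * bitSign (u i)) = ∏ i, Real.cosh (c i) := by
      rw [Fintype.expect_eq_sum_div_card]
      have h5 : ∏ i : ι, ∑ b : Bool, Real.exp (c i * bitSign b)
          = ∑ u : ι → Bool, Real.exp (∑ i, c i * bitSign (u i)) := by
        rw [Finset.prod_univ_sum, Fintype.piFinset_univ]
        exact Finset.sum_congr rfl fun u _ => (Real.exp_sum _ _).symm
      rw [← h5]
      have h6 : ∀ i, ∑ b : Bool, Real.exp (c i * bitSign b) = 2 * Real.cosh (c i) := fun i => by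
        simp only [Fintype.sum_bool, bitSign, Real.cosh_eq]
        simp
        ring
      simp_rw [h6]
      rw [Finset.prod_mul_distrib]
      simp
    rw [hprod, hw, Finset.sum_div, Real.exp_sum]
    exact Finset.prod_le_prod (fun i _ => (Real.cosh_pos _).le)
      fun i _ => Real.cosh_le_exp_half_sq _
  have hlog : w ≤ 2 * -Real.log m := by
    have h7 := hlow.trans hup
    have h8 := Real.log_le_log (by positivity) h7
    rw [Real.log_mul hpos.ne' (Real.exp_pos _).ne', Real.log_exp, Real.log_exp] at h8
    linarith
  have hsum : ∑ i, (𝔼 u : ι → Bool, H u * bitSign (u i)) ^ 2 / m = m * w := by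
    rw [hw, Finset.mul_sum]
    refine Finset.sum_congr rfl fun i _ => ?_
    rw [hci]
    field_simp
  rw [hsum]
  nlinarith

/-- The average of `F` after the bits outside `d` are set to `false`. -/
noncomputable def restr (F : (ι → Bool) → ℝ) (d : ι → Bool) : ℝ := 𝔼 u : ι → Bool,
  F (fun j => d j && u j)

/-- As `restr`, with the `i`-th bit set to `b`. -/
noncomputable def pin (F : (ι → Bool) → ℝ) (i : ι) (b : Bool) (d : ι → Bool) : ℝ :=
  𝔼 u : ι → Bool, F (Function.update (fun j => d j && u j) i b)

/-- The correlation of the restriction of `F` with the `i`-th bit. -/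
noncomputable def bias (F : (ι → Bool) → ℝ) (i : ι) (d : ι → Bool) : ℝ :=
  𝔼 u : ι → Bool, F (fun j => d j && u j) * bitSign (u i)

theorem restr_update_true (F : (ι → Bool) → ℝ) (i : ι) (d : ι → Bool) :
    restr F (Function.update d i true) = (pin F i false d + pin F i true d) / 2 := by
  rw [restr, expect_update i]
  simp_rw [update_true_and_update]
  rw [← Finset.expect_div, Finset.expect_add_distrib, pin, pin]

theorem restr_update_false (F : (ι → Bool) → ℝ) (i : ι) (d : ι → Bool) :
    restr F (Function.update d i false) = pin F i false d := by
  simp_rw [restr, update_false_and, pin]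

theorem bias_update_true (F : (ι → Bool) → ℝ) (i : ι) (d : ι → Bool) :
    bias F i (Function.update d i true) = (pin F i false d - pin F i true d) / 2 := by
  rw [bias, expect_update i]
  simp_rw [update_true_and_update]
  simp only [bitSign, Function.update_self, if_true, Bool.false_eq_true, if_false, mul_one,
    mul_neg, ← sub_eq_add_neg]
  rw [← Finset.expect_div, Finset.expect_sub_distrib, pin, pin]

theorem restr_nonneg {F : (ι → Bool) → ℝ} (h : ∀ u, 0 ≤ F u) (d : ι → Bool) : 0 ≤ restr F d :=
  Finset.expect_nonneg fun _ _ => h _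

theorem pin_nonneg {F : (ι → Bool) → ℝ} (h : ∀ u, 0 ≤ F u) (i : ι) (b : Bool) (d : ι → Bool) :
    0 ≤ pin F i b d :=
  Finset.expect_nonneg fun _ _ => h _

theorem sum_bias_sq_le {F : (ι → Bool) → ℝ} (h0 : ∀ u, 0 ≤ F u) (h1 : ∀ u, F u ≤ 1)
    (d : ι → Bool) :
    ∑ i, bias F i d ^ 2 / restr F d ≤ 2 * (restr F d * -Real.log (restr F d)) :=
  level_one (fun u => F (fun j => d j && u j)) (fun _ => h0 _) (fun _ => h1 _)

theorem mul_ge_of_small_bias {f₀ f₁ g₀ g₁ τ : ℝ} (hf₀ : 0 ≤ f₀) (hf₁ : 0 ≤ f₁) (hg₀ : 0 ≤ g₀)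
    (hg₁ : 0 ≤ g₁) (hτ : 0 < τ) :
    (1 - 9 * τ) * (((f₀ + f₁) / 2 * g₀ + f₀ * ((g₀ + g₁) / 2)) / 2)
      - 9 / (4 * τ) * ((((f₀ - f₁) / 2) ^ 2 / ((f₀ + f₁) / 2) * g₀
        + f₀ * (((g₀ - g₁) / 2) ^ 2 / ((g₀ + g₁) / 2))) / 2) ≤ f₁ * g₁ := by
  have bound : ∀ {x y : ℝ}, 0 ≤ x → 0 ≤ y → ∃ c : ℝ, 0 ≤ c ∧
      x * (1 - 2 * c) ≤ y ∧ (x + y) / 2 * (1 - c) ≤ x ∧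
      (x + y) / 2 * c ≤ (x + y) / 2 * τ + ((x - y) / 2) ^ 2 / ((x + y) / 2) / (4 * τ) := by
    intro x y hx hy
    rcases (add_nonneg hx hy).eq_or_lt with hz | hpos
    · have hx0 : x = 0 := by linarith
      have hy0 : y = 0 := by linarith
      exact ⟨0, le_rfl, by simp [hx0, hy0], by simp [hx0, hy0], by simp [hx0, hy0]⟩
    · set A := (x + y) / 2 with hA
      have hA0 : 0 < A := by linarith
      set h := (x - y) / 2 with hh
      have hxA : x = A + h := by rw [hA, hh]; ring
      have hyA : y = A - h := by rw [hA, hh]; ring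
      obtain ⟨c, hc, hcabs⟩ : ∃ c, c = |h| / A ∧ A * c = |h| := ⟨|h| / A, rfl, by field_simp⟩
      have hc0 : 0 ≤ c := by rw [hc]; positivity
      refine ⟨c, hc0, ?_, ?_, ?_⟩
      · rcases abs_cases h with ⟨ha, hs⟩ | ⟨ha, hs⟩
        · rw [ha] at hcabs
          rw [hxA, hyA]
          nlinarith
        · nlinarith
      · have := neg_abs_le h
        rw [hxA]
        nlinarith
      · have h3 : h ^ 2 / A / (4 * τ) = A * (c ^ 2 / (4 * τ)) := by
          rw [← sq_abs, ← hcabs]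
          field_simp
        rw [h3, ← mul_add]
        refine mul_le_mul_of_nonneg_left ?_ hA0.le
        have h4 : τ + c ^ 2 / (4 * τ) - c = (c - 2 * τ) ^ 2 / (4 * τ) := by
          field_simp
          ring
        have h5 : 0 ≤ (c - 2 * τ) ^ 2 / (4 * τ) := by positivity
        linarith
  obtain ⟨c, hc, hc1, hc2, hc3⟩ := bound hf₀ hf₁
  obtain ⟨e, he, he1, he2, he3⟩ := bound hg₀ hg₁
  set F := (f₀ + f₁) / 2 with hF
  set G := (g₀ + g₁) / 2 with hG
  set p := ((f₀ - f₁) / 2) ^ 2 / F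
  set r := ((g₀ - g₁) / 2) ^ 2 / G
  have hprod : f₀ * g₀ * (1 - 2 * c - 2 * e) ≤ f₁ * g₁ := by
    by_cases hs : 1 - 2 * c - 2 * e ≤ 0
    · exact (mul_nonpos_of_nonneg_of_nonpos (mul_nonneg hf₀ hg₀) hs).trans (mul_nonneg hf₁ hg₁)
    · have hs := not_le.1 hs
      have h1 : f₀ * (1 - 2 * c) * (g₀ * (1 - 2 * e)) ≤ f₁ * g₁ :=
        mul_le_mul hc1 he1 (mul_nonneg hg₀ (by linarith)) hf₁
      have h2 : 0 ≤ f₀ * g₀ * (4 * c * e) := by positivity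
      linarith
  have e1 : F * (1 - c) * g₀ ≤ f₀ * g₀ := mul_le_mul_of_nonneg_right hc2 hg₀
  have e2 : f₀ * (G * (1 - e)) ≤ f₀ * g₀ := mul_le_mul_of_nonneg_left he2 hf₀
  have e3 : f₀ * (g₀ * c) ≤ 2 * F * (g₀ * c) :=
    mul_le_mul_of_nonneg_right (by linarith) (mul_nonneg hg₀ hc)
  have e4 : g₀ * (f₀ * e) ≤ 2 * G * (f₀ * e) :=
    mul_le_mul_of_nonneg_right (by linarith) (mul_nonneg hf₀ he)
  have e5 : F * c * g₀ ≤ (F * τ + p / (4 * τ)) * g₀ := mul_le_mul_of_nonneg_right hc3 hg₀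
  have e6 : f₀ * (G * e) ≤ f₀ * (G * τ + r / (4 * τ)) := mul_le_mul_of_nonneg_left he3 hf₀
  have hfin : (1 - 9 * τ) * ((F * g₀ + f₀ * G) / 2) - 9 / (4 * τ) * ((p * g₀ + f₀ * r) / 2)
      = (F * g₀ + f₀ * G) / 2 - 9 / 2 * ((F * τ + p / (4 * τ)) * g₀)
        - 9 / 2 * (f₀ * (G * τ + r / (4 * τ))) := by
    field_simp
    ring
  rw [hfin]
  linarith

theorem mul_neg_log_le {h : ℝ} (h0 : 0 ≤ h) (L : ℝ) :
    h * -Real.log h ≤ L * h + Real.exp (-L) := by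
  rcases h0.eq_or_lt with hz | hpos
  · rw [← hz]
    simp [(Real.exp_pos _).le]
  · have h1 := Real.add_one_le_exp (-L - Real.log h)
    rw [Real.exp_sub, Real.exp_log hpos, le_div_iff₀ hpos] at h1
    nlinarith

/-- The mass of `A × B` under a distribution on disjoint pairs. -/
noncomputable def massDisjoint (F G : (ι → Bool) → ℝ) : ℝ :=
  𝔼 d : ι → Bool, restr F d * restr G (fun j => !d j)

/-- The mass of `A × B` under a distribution on pairs that intersect in one point. -/
noncomputable def massIntersect (F G : (ι → Bool) → ℝ) : ℝ :=
  ∑ i, 𝔼 d : ι → Bool, pin F i true d * pin G i true (fun j => !d j)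

theorem corruption {F G : (ι → Bool) → ℝ} (hF0 : ∀ u, 0 ≤ F u) (hF1 : ∀ u, F u ≤ 1)
    (hG0 : ∀ u, 0 ≤ G u) (hG1 : ∀ u, G u ≤ 1) {τ : ℝ} (hτ : 0 < τ) (L : ℝ) :
    ((1 - 9 * τ) * Fintype.card ι - 9 / (2 * τ) * L) * massDisjoint F G
      - 9 / (2 * τ) * Real.exp (-L) ≤ massIntersect F G := by
  set Φ : (ι → Bool) → ℝ := fun d => restr F d * restr G (fun j => !d j) with hΦ
  set Ψ : ι → (ι → Bool) → ℝ := fun i d =>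
    if d i then bias F i d ^ 2 / restr F d * restr G (fun j => !d j)
    else restr F d * (bias G i (fun j => !d j) ^ 2 / restr G (fun j => !d j)) with hΨ
  have hpt : ∀ i, (1 - 9 * τ) * 𝔼 d, Φ d - 9 / (4 * τ) * 𝔼 d, Ψ i d
      ≤ 𝔼 d : ι → Bool, pin F i true d * pin G i true (fun j => !d j) := by
    intro i
    rw [expect_update i Φ, expect_update i (Ψ i), Finset.mul_expect, Finset.mul_expect,
      ← Finset.expect_sub_distrib]
    refine Finset.expect_le_expect fun d _ => ?_
    have := mul_ge_of_small_bias (pin_nonneg hF0 i false d) (pin_nonneg hF0 i true d)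
      (pin_nonneg hG0 i false (fun j => !d j)) (pin_nonneg hG0 i true (fun j => !d j)) hτ
    simp only [hΦ, hΨ, not_update, Bool.not_false, Bool.not_true, restr_update_true,
      restr_update_false, bias_update_true, Function.update_self, if_true, Bool.false_eq_true,
      if_false]
    linarith
  have hΨsum : ∀ d, ∑ i, Ψ i d ≤ 2 * (L * Φ d + Real.exp (-L)) := by
    intro d
    set f := restr F d
    set g := restr G (fun j => !d j)
    have hf : 0 ≤ f := restr_nonneg hF0 _
    have hg : 0 ≤ g := restr_nonneg hG0 _
    have h1 : ∑ i, Ψ i d ≤ ∑ i, (bias F i d ^ 2 / f * g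
        + f * (bias G i (fun j => !d j) ^ 2 / g)) := by
      refine Finset.sum_le_sum fun i _ => ?_
      have p1 : 0 ≤ bias F i d ^ 2 / f * g := by positivity
      have p2 : 0 ≤ f * (bias G i (fun j => !d j) ^ 2 / g) := by positivity
      simp only [hΨ]
      split_ifs <;> linarith
    rw [Finset.sum_add_distrib, ← Finset.sum_mul, ← Finset.mul_sum] at h1
    have h2 := mul_le_mul_of_nonneg_right (sum_bias_sq_le hF0 hF1 d) hg
    have h3 := mul_le_mul_of_nonneg_left (sum_bias_sq_le hG0 hG1 (fun j => !d j)) hf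
    have h4 : f * g * -Real.log (f * g) = f * -Real.log f * g + f * (g * -Real.log g) := by
      rcases hf.eq_or_lt with hz | hf
      · simp [← hz]
      rcases hg.eq_or_lt with hz | hg
      · simp [← hz]
      rw [Real.log_mul hf.ne' hg.ne']
      ring
    have h5 := mul_neg_log_le (mul_nonneg hf hg) L
    rw [h4] at h5
    change _ ≤ 2 * (L * (f * g) + _)
    linarith
  have h1 := Finset.sum_le_sum fun i (_ : i ∈ (Finset.univ : Finset ι)) => hpt i
  rw [Finset.sum_sub_distrib, Finset.sum_const, ← Finset.mul_sum, ← Finset.expect_sum_comm,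
    Finset.card_univ, nsmul_eq_mul] at h1
  have h2 : 𝔼 d, ∑ i, Ψ i d ≤ 2 * (L * massDisjoint F G + Real.exp (-L)) := by
    refine (Finset.expect_le_expect fun d _ => hΨsum d).trans (le_of_eq ?_)
    rw [← Finset.mul_expect, Finset.expect_add_distrib, ← Finset.mul_expect]
    simp [massDisjoint, hΦ]
  have h3 : 9 / (4 * τ) * 𝔼 d, ∑ i, Ψ i d
      ≤ 9 / (4 * τ) * (2 * (L * massDisjoint F G + Real.exp (-L))) :=
    mul_le_mul_of_nonneg_left h2 (by positivity)
  have h4 : 9 / (4 * τ) * (2 * (L * massDisjoint F G + Real.exp (-L)))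
      = 9 / (2 * τ) * L * massDisjoint F G + 9 / (2 * τ) * Real.exp (-L) := by
    field_simp
    ring
  have h5 : massIntersect F G
      = ∑ i, 𝔼 d : ι → Bool, pin F i true d * pin G i true (fun j => !d j) := rfl
  have h6 : massDisjoint F G = 𝔼 d, Φ d := rfl
  rw [h5]
  rw [← h6] at h1
  linarith

end Corruption

/-! ### Deciding disjointness with a stable marriage -/

section Reduction

variable {κ W M : Type*}

/-- If each `w i` lists the men `m j` with `x (i, j)` and then `m' i`, each `m' i` lists `w i` and
then `p`, the woman `p` accepts exactly the `m' i`, and `m j` accepts exactly the `w i` with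
`y (i, j)`, then `p` is single iff `x` and `y` are disjoint. -/
theorem IsStable.single_iff_disjoint {PW : Profile W M} {PM : Profile M W} {μ : Marriage W M}
    (hμ : IsStable PW PM μ) {x y : κ × κ → Bool} {a : Option κ → W} {e : κ ⊕ κ → M}
    (ha : Function.Injective a) (he : Function.Injective e)
    (w_acc : ∀ i m, (PW (a (some i))).Accepts m ↔
      (∃ j, x (i, j) = true ∧ m = e (.inl j)) ∨ m = e (.inr i))
    (w_pref : ∀ i j, x (i, j) = true → (PW (a (some i))).Prefers (e (.inl j)) (e (.inr i)))
    (p_acc : ∀ i, (PW (a none)).Accepts (e (.inr i)))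
    (p_acc' : ∀ m, (PW (a none)).Accepts m → ∃ i, m = e (.inr i))
    (m_acc : ∀ j w, (PM (e (.inl j))).Accepts w ↔ ∃ i, y (i, j) = true ∧ w = a (some i))
    (m_acc' : ∀ i w, (PM (e (.inr i))).Accepts w ↔ w = a (some i) ∨ w = a none)
    (m_pref : ∀ i, (PM (e (.inr i))).Prefers (a (some i)) (a none)) :
    μ (a none) = none ↔ ∀ z, ¬(x z = true ∧ y z = true) := by
  constructor
  · rintro hp ⟨i, j⟩ ⟨hx, hy⟩
    have hspouse : ∀ l, μ (a (some l)) = some (e (.inr l)) := by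
      intro l
      rcases hs : μ.symm (e (.inr l)) with _ | w
      · refine absurd ?_ (hμ.no_blocking (a none) (e (.inr l)))
        refine ⟨?_, ?_⟩
        · rw [hp]
          exact p_acc l
        · rw [hs]
          exact (m_acc' l _).2 (.inr rfl)
      · have hw := (PEquiv.eq_some_iff μ).1 hs
        rcases (m_acc' l w).1 (hμ.man_accepts _ _ hw) with rfl | rfl
        · exact hw
        · rw [hp] at hw
          exact absurd hw (by simp)
    refine hμ.no_blocking (a (some i)) (e (.inl j)) ⟨?_, ?_⟩
    · rw [hspouse]
      exact w_pref i j hx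
    · rcases hs : μ.symm (e (.inl j)) with _ | w
      · exact (m_acc j _).2 ⟨i, hy, rfl⟩
      · have hw := (PEquiv.eq_some_iff μ).1 hs
        obtain ⟨l, -, rfl⟩ := (m_acc j w).1 (hμ.man_accepts _ _ hw)
        rw [hspouse] at hw
        exact absurd (he (Option.some.inj hw)) (by simp)
  · intro hdisj
    by_contra hne
    obtain ⟨m, hm⟩ := Option.ne_none_iff_exists'.1 hne
    obtain ⟨i, rfl⟩ := p_acc' m (hμ.woman_accepts _ _ hm)
    refine hμ.no_blocking (a (some i)) (e (.inr i)) ⟨?_, ?_⟩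
    · rcases hs : μ (a (some i)) with _ | m
      · exact (w_acc i _).2 (.inr rfl)
      · rcases (w_acc i m).1 (hμ.woman_accepts _ _ hs) with ⟨j, hx, rfl⟩ | rfl
        · obtain ⟨i', hy, hi'⟩ := (m_acc j _).1 (hμ.man_accepts _ _ hs)
          obtain rfl : i = i' := Option.some.inj (ha hi')
          exact absurd ⟨hx, hy⟩ (hdisj (i, j))
        · exact absurd (ha (μ.inj hs hm)) (by simp)
    · rw [(PEquiv.eq_some_iff μ).2 hm]
      exact m_pref i

variable [Fintype κ]

/-- The women's lists that encode `x`. -/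
noncomputable def womenProfile (a : Option κ → W) (e : κ ⊕ κ ↪ M) (x : κ × κ → Bool) :
    Profile W M := fun w =>
  match Function.partialInv a w with
  | some (some i) => ⟨(((Finset.univ.filter fun j => x (i, j) = true).toList.map Sum.inl) ++
      [Sum.inr i]).map e, List.Nodup.map e.injective <| by
        refine List.Nodup.append ((Finset.nodup_toList _).map Sum.inl_injective) (by simp) ?_
        simp [List.Disjoint]⟩
  | some none => ⟨(Finset.univ.toList.map Sum.inr).map e,
      List.Nodup.map e.injective ((Finset.nodup_toList _).map Sum.inr_injective)⟩
  | none => ⟨[], List.nodup_nil⟩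

/-- The men's lists that encode `y`. -/
noncomputable def menProfile (a : Option κ ↪ W) (e : κ ⊕ κ → M) (y : κ × κ → Bool) :
    Profile M W := fun m =>
  match Function.partialInv e m with
  | some (.inl j) => ⟨((Finset.univ.filter fun i => y (i, j) = true).toList.map some).map a,
      List.Nodup.map a.injective ((Finset.nodup_toList _).map (Option.some_injective _))⟩
  | some (.inr i) => ⟨[some i, none].map a, List.Nodup.map a.injective (by simp)⟩
  | none => ⟨[], List.nodup_nil⟩

theorem partialInv_apply {α β : Type*} {f : α → β} (hf : Function.Injective f) (z : α) :
    Function.partialInv f (f z) = some z :=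
  (hf.isPartialInv z (f z)).2 rfl

theorem singleInSome_iff_disjoint (a : Option κ ↪ W) (e : κ ⊕ κ ↪ M) (x y : κ × κ → Bool) :
    SingleInSome (.inl (a none)) (womenProfile a e x) (menProfile a e y) ↔
      ∀ z, ¬(x z = true ∧ y z = true) := by
  have key : ∀ μ, IsStable (womenProfile a e x) (menProfile a e y) μ →
      (μ (a none) = none ↔ ∀ z, ¬(x z = true ∧ y z = true)) := by
    intro μ hμ
    refine hμ.single_iff_disjoint a.injective e.injective ?_ ?_ ?_ ?_ ?_ ?_ ?_
    · intro i m
      simp [womenProfile, PrefList.Accepts, partialInv_apply a.injective,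
        eq_comm (a := m)]
    · intro i j hx
      left
      simp only [womenProfile, partialInv_apply a.injective]
      refine (List.Sublist.map e (l₁ := [Sum.inl j] ++ [Sum.inr i]) ?_)
      refine List.Sublist.append ?_ (List.Sublist.refl _)
      rw [List.singleton_sublist]
      simpa using hx
    · intro i
      simp [womenProfile, PrefList.Accepts, partialInv_apply a.injective]
    · intro m hm
      simpa [womenProfile, PrefList.Accepts, partialInv_apply a.injective,
        eq_comm (a := m)] using hm
    · intro j w
      simp [menProfile, PrefList.Accepts, partialInv_apply e.injective,
        eq_comm (a := w)]
    · intro i w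
      simp [menProfile, PrefList.Accepts, partialInv_apply e.injective]
    · intro i
      left
      simp [menProfile, partialInv_apply e.injective]
  obtain ⟨μ, hμ⟩ := exists_isStable (womenProfile a e x) (menProfile a e y)
  constructor
  · rintro ⟨ν, hν, hs⟩
    exact (key ν hν).1 hs
  · exact fun h => ⟨μ, hμ, (key μ hμ).2 h⟩

end Reduction

theorem exists_embeddings {n k : ℕ} (h : 2 * k + 1 ≤ n) (p : Fin n) :
    (∃ a : Option (Fin k) ↪ Fin n, a none = p) ∧ Nonempty (Fin k ⊕ Fin k ↪ Fin n) := by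
  constructor
  · obtain ⟨f⟩ : Nonempty (Fin k ↪ {i : Fin n // i ≠ p}) := by
      refine Function.Embedding.nonempty_of_card_le ?_
      simp
      omega
    refine ⟨⟨fun o => o.elim p fun i => f i, ?_⟩, rfl⟩
    rintro (_ | i) (_ | j) hij
    · rfl
    · exact absurd hij.symm (f j).2
    · exact absurd hij (f i).2
    · exact congrArg some (f.injective (Subtype.ext hij))
  · refine Function.Embedding.nonempty_of_card_le ?_
    simp
    omega

/-- Deciding whether `p` is single is at least as hard as deciding disjointness. -/
theorem exists_encoding {n k : ℕ} (h : 2 * k + 1 ≤ n) (p : Fin n ⊕ Fin n) :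
    ∃ φ ψ : (Fin k × Fin k → Bool) → Profile (Fin n) (Fin n), ∀ x y,
      SingleInSome p (φ x) (ψ y) ↔ ∀ z, ¬(x z = true ∧ y z = true) := by
  rcases p with p | p
  · obtain ⟨⟨a, rfl⟩, ⟨e⟩⟩ := exists_embeddings h p
    exact ⟨womenProfile a e, menProfile a e, singleInSome_iff_disjoint a e⟩
  · obtain ⟨⟨a, rfl⟩, ⟨e⟩⟩ := exists_embeddings h p
    refine ⟨menProfile a e, womenProfile a e, fun x y => ?_⟩
    refine (singleInSome_swap (.inl (a none))).trans ((singleInSome_iff_disjoint a e y x).trans ?_)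
    simp only [and_comm]

section Disjointness

open Finset
open scoped BigOperators

variable {ι : Type*} [Fintype ι] [DecidableEq ι]

/-- The mean of `V` under a distribution on disjoint pairs. -/
noncomputable def meanDisjoint (V : (ι → Bool) → (ι → Bool) → ℝ) : ℝ :=
  𝔼 d : ι → Bool, 𝔼 u : ι → Bool, 𝔼 v : ι → Bool, V (fun j => d j && u j) (fun j => !d j && v j)

/-- The sum, over `i`, of the means of `V` under distributions on pairs that intersect in `i`. -/
noncomputable def meanIntersect (V : (ι → Bool) → (ι → Bool) → ℝ) : ℝ :=
  ∑ i, 𝔼 d : ι → Bool, 𝔼 u : ι → Bool, 𝔼 v : ι → Bool,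
    V (Function.update (fun j => d j && u j) i true) (Function.update (fun j => !d j && v j) i true)

theorem meanDisjoint_mul (F G : (ι → Bool) → ℝ) :
    meanDisjoint (fun x y => F x * G y) = massDisjoint F G := by
  simp only [meanDisjoint, massDisjoint, restr, Finset.expect_mul_expect]

theorem meanIntersect_mul (F G : (ι → Bool) → ℝ) :
    meanIntersect (fun x y => F x * G y) = massIntersect F G := by
  simp only [meanIntersect, massIntersect, pin, Finset.expect_mul_expect]

theorem meanDisjoint_add (V V' : (ι → Bool) → (ι → Bool) → ℝ) :
    meanDisjoint (fun x y => V x y + V' x y) = meanDisjoint V + meanDisjoint V' := by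
  simp only [meanDisjoint, Finset.expect_add_distrib]

theorem meanIntersect_add (V V' : (ι → Bool) → (ι → Bool) → ℝ) :
    meanIntersect (fun x y => V x y + V' x y) = meanIntersect V + meanIntersect V' := by
  simp only [meanIntersect, Finset.expect_add_distrib, Finset.sum_add_distrib]

/-- The indicator of a bit. -/
def bitInd (b : Bool) : ℝ := if b then 1 else 0

theorem bitInd_nonneg (b : Bool) : 0 ≤ bitInd b := by cases b <;> simp [bitInd]

theorem bitInd_le_one (b : Bool) : bitInd b ≤ 1 := by cases b <;> simp [bitInd]

theorem bitInd_and (b b' : Bool) : bitInd (b && b') = bitInd b * bitInd b' := by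
  cases b <;> simp [bitInd]

theorem bitInd_split (c : Bool) (g : Bool → Bool) :
    bitInd (g c) = bitInd c * bitInd (g true) + bitInd (!c) * bitInd (g false) := by
  cases c <;> simp [bitInd]

theorem meanDisjoint_zero : meanDisjoint (fun _ _ : ι → Bool => (0 : ℝ)) = 0 := by
  simp [meanDisjoint]

theorem meanIntersect_zero : meanIntersect (fun _ _ : ι → Bool => (0 : ℝ)) = 0 := by
  simp [meanIntersect]

/-- Corruption of rectangles carries over to protocols with few bits. -/
theorem Protocol.corruption {α β : Type*} {φ : (ι → Bool) → α} {ψ : (ι → Bool) → β} {r η : ℝ}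
    (hη : 0 ≤ η)
    (hrect : ∀ A B : (ι → Bool) → Bool,
      r * massDisjoint (fun x => bitInd (A x)) (fun y => bitInd (B y)) - η
        ≤ massIntersect (fun x => bitInd (A x)) (fun y => bitInd (B y)))
    (T : Protocol α β) : ∀ (c : ℕ) (A B : (ι → Bool) → Bool),
      (∀ x y, A x = true → B y = true → T.bits (φ x) (ψ y) ≤ c) →
      r * meanDisjoint (fun x y => bitInd (A x) * bitInd (B y) * bitInd (T.run (φ x) (ψ y)))
        - 2 ^ c * η
        ≤ meanIntersect (fun x y => bitInd (A x) * bitInd (B y) * bitInd (T.run (φ x) (ψ y))) := by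
  have hzero : ∀ (c : ℕ) (V : (ι → Bool) → (ι → Bool) → ℝ), (∀ x y, V x y = 0) →
      r * meanDisjoint V - 2 ^ c * η ≤ meanIntersect V := by
    intro c V hV
    obtain rfl : V = fun _ _ => 0 := funext₂ hV
    rw [meanDisjoint_zero, meanIntersect_zero]
    have : 0 ≤ 2 ^ c * η := by positivity
    linarith
  have hempty : ∀ (A B : (ι → Bool) → Bool) (v : (ι → Bool) → (ι → Bool) → ℝ),
      (∀ x y, A x = true → B y = true → False) → ∀ x y, bitInd (A x) * bitInd (B y) * v x y = 0 := by
    intro A B v h x y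
    have := h x y
    cases hA : A x <;> cases hB : B y <;> simp_all [bitInd]
  induction T with
  | output b =>
    intro c A B _
    cases b with
    | false => exact hzero c _ fun x y => by simp [Protocol.run, bitInd]
    | true =>
      have h1 : ∀ x y, bitInd (A x) * bitInd (B y) *
          bitInd ((Protocol.output true : Protocol α β).run (φ x) (ψ y))
          = bitInd (A x) * bitInd (B y) := fun x y => by simp [Protocol.run, bitInd]
      simp only [h1]
      rw [meanDisjoint_mul, meanIntersect_mul]
      have h2 : (1 : ℝ) ≤ 2 ^ c := one_le_pow₀ (by norm_num)
      have := hrect A B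
      nlinarith
  | alice msg next ih =>
    intro c A B hc
    cases c with
    | zero =>
      refine hzero 0 _ (hempty A B _ fun x y hA hB => ?_)
      exact absurd (hc x y hA hB) (by simp [Protocol.bits])
    | succ c =>
      have h1 : ∀ x y, bitInd (A x) * bitInd (B y) *
          bitInd ((Protocol.alice msg next).run (φ x) (ψ y))
          = bitInd (A x && msg (φ x)) * bitInd (B y) * bitInd ((next true).run (φ x) (ψ y))
          + bitInd (A x && !msg (φ x)) * bitInd (B y) * bitInd ((next false).run (φ x) (ψ y)) := by
        intro x y
        rw [Protocol.run, bitInd_split (msg (φ x)) fun b => (next b).run (φ x) (ψ y),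
          bitInd_and, bitInd_and]
        ring
      simp only [h1]
      rw [meanDisjoint_add, meanIntersect_add]
      have ht := ih true c (fun x => A x && msg (φ x)) B fun x y hA hB => by
        rw [Bool.and_eq_true] at hA
        have := hc x y hA.1 hB
        rw [Protocol.bits, hA.2] at this
        omega
      have hf := ih false c (fun x => A x && !msg (φ x)) B fun x y hA hB => by
        rw [Bool.and_eq_true, Bool.not_eq_true'] at hA
        have := hc x y hA.1 hB
        rw [Protocol.bits, hA.2] at this
        omega
      rw [pow_succ]
      linarith
  | bob msg next ih =>
    intro c A B hc
    cases c with
    | zero =>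
      refine hzero 0 _ (hempty A B _ fun x y hA hB => ?_)
      exact absurd (hc x y hA hB) (by simp [Protocol.bits])
    | succ c =>
      have h1 : ∀ x y, bitInd (A x) * bitInd (B y) *
          bitInd ((Protocol.bob msg next).run (φ x) (ψ y))
          = bitInd (A x) * bitInd (B y && msg (ψ y)) * bitInd ((next true).run (φ x) (ψ y))
          + bitInd (A x) * bitInd (B y && !msg (ψ y)) * bitInd ((next false).run (φ x) (ψ y)) := by
        intro x y
        rw [Protocol.run, bitInd_split (msg (ψ y)) fun b => (next b).run (φ x) (ψ y),
          bitInd_and, bitInd_and]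
        ring
      simp only [h1]
      rw [meanDisjoint_add, meanIntersect_add]
      have ht := ih true c A (fun y => B y && msg (ψ y)) fun x y hA hB => by
        rw [Bool.and_eq_true] at hB
        have := hc x y hA hB.1
        rw [Protocol.bits, hB.2] at this
        omega
      have hf := ih false c A (fun y => B y && !msg (ψ y)) fun x y hA hB => by
        rw [Bool.and_eq_true, Bool.not_eq_true'] at hB
        have := hc x y hA hB.1
        rw [Protocol.bits, hB.2] at this
        omega
      rw [pow_succ]
      linarith

theorem hasSum_expect {γ S : Type*} [Fintype γ] {f : γ → S → ℝ} {a : γ → ℝ}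
    (h : ∀ i, HasSum (f i) (a i)) : HasSum (fun s => 𝔼 i, f i s) (𝔼 i, a i) := by
  simp only [Fintype.expect_eq_sum_div_card]
  exact (hasSum_sum fun i _ => h i).div_const _

theorem hasSum_meanDisjoint {S : Type*} {V : S → (ι → Bool) → (ι → Bool) → ℝ}
    {a : (ι → Bool) → (ι → Bool) → ℝ} (h : ∀ x y, HasSum (fun s => V s x y) (a x y)) :
    HasSum (fun s => meanDisjoint (V s)) (meanDisjoint a) :=
  hasSum_expect fun _ => hasSum_expect fun _ => hasSum_expect fun _ => h _ _

theorem hasSum_meanIntersect {S : Type*} {V : S → (ι → Bool) → (ι → Bool) → ℝ}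
    {a : (ι → Bool) → (ι → Bool) → ℝ} (h : ∀ x y, HasSum (fun s => V s x y) (a x y)) :
    HasSum (fun s => meanIntersect (V s)) (meanIntersect a) :=
  hasSum_sum fun _ _ => hasSum_expect fun _ => hasSum_expect fun _ => hasSum_expect fun _ => h _ _

theorem meanDisjoint_const_mul (t : ℝ) (V : (ι → Bool) → (ι → Bool) → ℝ) :
    meanDisjoint (fun x y => t * V x y) = t * meanDisjoint V := by
  simp only [meanDisjoint, Finset.mul_expect]

theorem meanIntersect_const_mul (t : ℝ) (V : (ι → Bool) → (ι → Bool) → ℝ) :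
    meanIntersect (fun x y => t * V x y) = t * meanIntersect V := by
  simp only [meanIntersect, Finset.mul_expect, Finset.mul_sum]

theorem le_meanDisjoint {V : (ι → Bool) → (ι → Bool) → ℝ} {q : ℝ}
    (h : ∀ x y, (∀ z, ¬(x z = true ∧ y z = true)) → q ≤ V x y) : q ≤ meanDisjoint V := by
  have h1 : (𝔼 _d : ι → Bool, 𝔼 _u : ι → Bool, 𝔼 _v : ι → Bool, q) ≤ meanDisjoint V :=
    Finset.expect_le_expect fun d _ => Finset.expect_le_expect fun u _ =>
      Finset.expect_le_expect fun v _ => h _ _ fun z => by cases d z <;> simp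
  simpa using h1

theorem meanIntersect_le {V : (ι → Bool) → (ι → Bool) → ℝ} {q : ℝ}
    (h : ∀ x y, ¬(∀ z, ¬(x z = true ∧ y z = true)) → V x y ≤ q) :
    meanIntersect V ≤ Fintype.card ι * q := by
  have h1 : meanIntersect V
      ≤ ∑ _i : ι, 𝔼 _d : ι → Bool, 𝔼 _u : ι → Bool, 𝔼 _v : ι → Bool, q :=
    Finset.sum_le_sum fun i _ => Finset.expect_le_expect fun d _ =>
      Finset.expect_le_expect fun u _ => Finset.expect_le_expect fun v _ =>
        h _ _ fun hz => hz i (by simp)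
  simpa using h1

theorem hasSum_map_true {S : Type*} (P : PMF S) (g : S → Bool) :
    HasSum (fun s => (P s).toReal * bitInd (g s)) ((P.map g) true).toReal := by
  have hm := PMF.map_apply g P true
  have h := ENNReal.hasSum_toReal (hm ▸ PMF.apply_ne_top (P.map g) true)
  rw [← ENNReal.tsum_toReal_eq fun s => by split_ifs; exacts [PMF.apply_ne_top _ _, by simp],
    ← hm] at h
  convert h using 2 with s
  cases g s <;> simp [bitInd]

theorem toReal_true_add_false (Q : PMF Bool) : (Q true).toReal + (Q false).toReal = 1 := by
  have h := Q.tsum_coe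
  rw [tsum_fintype, Fintype.sum_bool] at h
  rw [← ENNReal.toReal_add (PMF.apply_ne_top _ _) (PMF.apply_ne_top _ _), h, ENNReal.toReal_one]

/-- The randomized communication complexity of disjointness is linear. -/
theorem disjointness_lower_bound {q : ℝ} (hq : 1 / 2 < q) (hq1 : q ≤ 1) :
    ∃ δ : ℝ, 0 < δ ∧ ∃ N₀ : ℕ, ∀ k : ℕ, N₀ ≤ k → ∀ {α β S : Type} (T : S → Protocol α β)
      (f : α → β → Bool) (φ : (Fin k × Fin k → Bool) → α)
      (ψ : (Fin k × Fin k → Bool) → β),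
      (∀ x y : Fin k × Fin k → Bool, f (φ x) (ψ y) = true ↔ ∀ z, ¬(x z = true ∧ y z = true)) →
      ∀ P : PMF S, (∀ x y, ENNReal.ofReal q ≤ (P.map fun s => (T s).run x y) (f x y)) →
      ∀ c : ℕ, (∀ s ∈ P.support, ∀ x y, (T s).bits x y ≤ c) → δ * (k : ℝ) ^ 2 ≤ c := by
  obtain ⟨τ, hτ⟩ : ∃ τ, τ = (2 * q - 1) / 19 := ⟨_, rfl⟩
  have hτ0 : 0 < τ := by rw [hτ]; linarith
  have hτ1 : τ ≤ 1 / 19 := by rw [hτ]; linarith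
  set K := 9 / (2 * τ) with hK
  have hK0 : 0 < K := by positivity
  obtain ⟨N₁, hN₁⟩ := exists_nat_ge (Real.log (K / τ) / τ ^ 2)
  refine ⟨τ ^ 2, by positivity, N₁ + 1, fun k hk α β S T f φ ψ hf P hP c hc => ?_⟩
  set N : ℝ := (k : ℝ) ^ 2 with hN
  have hk1 : (1 : ℝ) ≤ k := by exact_mod_cast (by omega : 1 ≤ k)
  have hkN : (k : ℝ) ≤ N := by rw [hN]; nlinarith
  have hcard : (Fintype.card (Fin k × Fin k) : ℝ) = N := by
    simp [hN, sq]
  have hNlog : Real.log (K / τ) ≤ τ ^ 2 * N := by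
    have h1 : (N₁ : ℝ) ≤ k := by exact_mod_cast (by omega : N₁ ≤ k)
    have h2 := (div_le_iff₀ (by positivity)).1 ((hN₁.trans h1).trans hkN)
    linarith
  set η := K * Real.exp (-(2 * τ ^ 2 * N)) with hη
  have hη0 : 0 ≤ η := by positivity
  have hrect : ∀ A B : (Fin k × Fin k → Bool) → Bool,
      (1 - 18 * τ) * N * massDisjoint (fun x => bitInd (A x)) (fun y => bitInd (B y)) - η
        ≤ massIntersect (fun x => bitInd (A x)) (fun y => bitInd (B y)) := by
    intro A B
    have h1 := _root_.corruption (F := fun x => bitInd (A x)) (G := fun y => bitInd (B y))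
      (fun _ => bitInd_nonneg _) (fun _ => bitInd_le_one _) (fun _ => bitInd_nonneg _)
      (fun _ => bitInd_le_one _) hτ0 (2 * τ ^ 2 * N)
    have h2 : (1 - 9 * τ) * (Fintype.card (Fin k × Fin k) : ℝ) - 9 / (2 * τ) * (2 * τ ^ 2 * N)
        = (1 - 18 * τ) * N := by
      rw [hcard]
      field_simp
      ring
    rwa [h2] at h1
  set a : (Fin k × Fin k → Bool) → (Fin k × Fin k → Bool) → ℝ := fun x y =>
    ((P.map fun s => (T s).run (φ x) (ψ y)) true).toReal with ha
  have hsum : ∀ x y, HasSum (fun s => (P s).toReal * bitInd ((T s).run (φ x) (ψ y))) (a x y) :=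
    fun x y => hasSum_map_true P _
  have hsD := hasSum_meanDisjoint hsum
  have hsI := hasSum_meanIntersect hsum
  simp only [meanDisjoint_const_mul] at hsD
  simp only [meanIntersect_const_mul] at hsI
  have hP1 : HasSum (fun s => (P s).toReal) 1 := by
    have h := ENNReal.hasSum_toReal P.tsum_coe_ne_top
    rwa [← ENNReal.tsum_toReal_eq fun s => PMF.apply_ne_top _ _, P.tsum_coe,
      ENNReal.toReal_one] at h
  have hmain : (1 - 18 * τ) * N * meanDisjoint a - 2 ^ c * η ≤ meanIntersect a := by
    have h1 := (hsD.mul_left ((1 - 18 * τ) * N)).sub (hP1.mul_right (2 ^ c * η))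
    rw [one_mul] at h1
    refine hasSum_le (fun s => ?_) h1 hsI
    by_cases hs : P s = 0
    · simp [hs]
    · have h2 := Protocol.corruption (φ := φ) (ψ := ψ) hη0 hrect (T s) c (fun _ => true)
        (fun _ => true) fun x y _ _ => hc s ((P.mem_support_iff s).2 hs) _ _
      have h3 : ∀ x y, bitInd true * bitInd true * bitInd ((T s).run (φ x) (ψ y))
          = bitInd ((T s).run (φ x) (ψ y)) := fun x y => by simp [bitInd]
      simp only [h3] at h2
      have h4 := mul_le_mul_of_nonneg_left h2 (ENNReal.toReal_nonneg (a := P s))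
      linarith
  have hprob : ∀ x y, q ≤ ((P.map fun s => (T s).run (φ x) (ψ y)) (f (φ x) (ψ y))).toReal :=
    fun x y => (ENNReal.ofReal_le_iff_le_toReal (PMF.apply_ne_top _ _)).1 (hP _ _)
  have hD : q ≤ meanDisjoint a := le_meanDisjoint fun x y hxy => by
    have := hprob x y
    rwa [(hf x y).2 hxy] at this
  have hI : meanIntersect a ≤ N * (1 - q) := by
    rw [← hcard]
    refine meanIntersect_le fun x y hxy => ?_
    have h1 := hprob x y
    rw [Bool.eq_false_iff.2 fun h => hxy ((hf x y).1 h)] at h1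
    have h2 := toReal_true_add_false (P.map fun s => (T s).run (φ x) (ψ y))
    have h3 : a x y = ((P.map fun s => (T s).run (φ x) (ψ y)) true).toReal := rfl
    linarith
  have hN1 : 1 ≤ N := hk1.trans hkN
  have h1 : (1 - 18 * τ) * N * q ≤ (1 - 18 * τ) * N * meanDisjoint a :=
    mul_le_mul_of_nonneg_left hD (mul_nonneg (by linarith) (by linarith))
  have h2 : N * τ ≤ 2 ^ c * η := by
    have h3 : N * τ ≤ N * ((1 - 18 * τ) * q - (1 - q)) := by
      refine mul_le_mul_of_nonneg_left ?_ (by linarith)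
      have : q * τ ≤ τ := by nlinarith
      have : 19 * τ = 2 * q - 1 := by rw [hτ]; ring
      linarith
    linarith
  have h3 : τ ≤ Real.exp c * η := by
    have h4 : (2 : ℝ) ^ c ≤ Real.exp c := by
      rw [← Real.exp_one_pow c]
      exact pow_le_pow_left₀ (by norm_num) (by linarith [Real.add_one_le_exp 1]) c
    have := mul_le_mul_of_nonneg_right h4 hη0
    nlinarith
  have h5 : 2 * τ ^ 2 * N ≤ c + Real.log (K / τ) := by
    have h6 := Real.log_le_log hτ0 h3
    rw [hη, Real.log_mul (Real.exp_pos _).ne' (by positivity),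
      Real.log_mul hK0.ne' (Real.exp_pos _).ne', Real.log_exp, Real.log_exp] at h6
    rw [Real.log_div hK0.ne' hτ0.ne']
    linarith
  linarith

end Disjointness

/-! ### Complexity measures -/

/-- The protocol in which the owner of the queried input announces the answer. -/
def QueryAlgorithm.toProtocol {α β : Type*} : QueryAlgorithm α β → Protocol α β
  | output b => .output b
  | ask (.inl g) next => .alice g fun b => (next b).toProtocol
  | ask (.inr g) next => .bob g fun b => (next b).toProtocol

theorem QueryAlgorithm.run_toProtocol {α β : Type*} (s : QueryAlgorithm α β) (x : α) (y : β) :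
    s.toProtocol.run x y = s.run x y := by
  induction s with
  | output b => rfl
  | ask query next ih => rcases query with g | g <;> exact ih _

theorem QueryAlgorithm.bits_toProtocol {α β : Type*} (s : QueryAlgorithm α β) (x : α) (y : β) :
    s.toProtocol.bits x y = s.queries x y := by
  induction s with
  | output b => rfl
  | ask query next ih => rcases query with g | g <;> exact congrArg (· + 1) (ih _)

theorem ofReal_le_randomizedComplexity {S α β : Type*} {run : S → α → β → Bool}
    {cost : S → α → β → ℕ} {q r : ℝ} {f : α → β → Bool}
    (h : ∀ P : PMF S, (∀ x y, ENNReal.ofReal q ≤ (P.map fun s => run s x y) (f x y)) →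
      ∀ c : ℕ, (∀ s ∈ P.support, ∀ x y, cost s x y ≤ c) → r ≤ c) :
    ENNReal.ofReal r ≤ (randomizedComplexity run cost q f : ℝ≥0∞) := by
  have h1 : ENNReal.ofReal r ≤ ((⌈r⌉₊ : ℕ∞) : ℝ≥0∞) := by
    rw [ENat.toENNReal_coe, ← ENNReal.ofReal_natCast]
    exact ENNReal.ofReal_le_ofReal (Nat.le_ceil r)
  refine h1.trans (ENat.toENNReal_le.2 (le_iInf₂ fun P hP => ?_))
  by_contra hlt
  obtain ⟨c, hc⟩ := ENat.ne_top_iff_exists.1 (ne_top_of_lt (not_le.1 hlt))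
  rw [← hc] at hlt
  refine hlt (Nat.cast_le.2 (Nat.ceil_le.2 (h P hP c fun s hs x y => ?_)))
  have h2 : (cost s x y : ℕ∞) ≤ c := by
    rw [hc]
    exact (le_iSup₂ (f := fun x y => (cost s x y : ℕ∞)) x y).trans
      (le_iSup₂ (f := fun s (_ : s ∈ P.support) => ⨆ (x : α) (y : β), (cost s x y : ℕ∞)) s hs)
  exact_mod_cast h2

theorem randomizedComplexity_le_deterministicComplexity {S α β : Type*}
    (run : S → α → β → Bool) (cost : S → α → β → ℕ) {q : ℝ} (hq : q ≤ 1) (f : α → β → Bool) :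
    randomizedComplexity run cost q f ≤ deterministicComplexity run cost f := by
  refine le_iInf₂ fun s hs => ?_
  refine iInf₂_le_of_le (PMF.pure s) (fun x y => ?_) ?_
  · rw [PMF.pure_map, hs, PMF.pure_apply, if_pos rfl]
    exact ENNReal.ofReal_le_one.2 hq
  · simp

theorem mainTheorem12 :
    (∀ (n : ℕ) (p : Fin n ⊕ Fin n) (PW : Profile (Fin n) (Fin n)) (PM : Profile (Fin n) (Fin n)),
      SingleInSome p PW PM ↔ SingleInEvery p PW PM) ∧
    ∀ q : ℝ, 1 / 2 < q → q ≤ 1 → ∃ c : ℝ, 0 < c ∧ ∃ N : ℕ, ∀ n : ℕ, N ≤ n →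
      ∀ p : Fin n ⊕ Fin n,
        ∀ R : Profile (Fin n) (Fin n) → Profile (Fin n) (Fin n) → Prop,
          R = SingleInSome p ∨ R = SingleInEvery p →
            ENNReal.ofReal (c * (n : ℝ) ^ 2) ≤
                (randomizedCommunicationComplexity q (decisionProblem R) : ℝ≥0∞) ∧
            ENNReal.ofReal (c * (n : ℝ) ^ 2) ≤
                (communicationComplexity (decisionProblem R) : ℝ≥0∞) ∧
            ENNReal.ofReal (c * (n : ℝ) ^ 2) ≤
                (randomizedQueryComplexity q (decisionProblem R) : ℝ≥0∞) ∧
            ENNReal.ofReal (c * (n : ℝ) ^ 2) ≤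
                (queryComplexity (decisionProblem R) : ℝ≥0∞) := by
  refine ⟨fun n p PW PM => singleInSome_iff_singleInEvery p PW PM, fun q hq hq1 => ?_⟩
  obtain ⟨δ, hδ, N₀, hbound⟩ := disjointness_lower_bound hq hq1
  refine ⟨δ / 16, by positivity, 2 * N₀ + 4, fun n hn p R hR => ?_⟩
  have hR : ∀ PW PM, R PW PM ↔ SingleInSome p PW PM := by
    rcases hR with rfl | rfl
    · exact fun _ _ => Iff.rfl
    · exact fun PW PM => (singleInSome_iff_singleInEvery p PW PM).symm
  obtain ⟨k, hk⟩ : ∃ k, k = (n - 1) / 2 := ⟨_, rfl⟩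
  obtain ⟨φ, ψ, hφψ⟩ := exists_encoding (show 2 * k + 1 ≤ n by omega) p
  have hf : ∀ x y, decisionProblem R (φ x) (ψ y) = true ↔ ∀ z, ¬(x z = true ∧ y z = true) := by
    intro x y
    classical
    rw [← hφψ, ← hR]
    simp [decisionProblem]
  have hkn : δ / 16 * (n : ℝ) ^ 2 ≤ δ * (k : ℝ) ^ 2 := by
    have h1 : (n : ℝ) ≤ 4 * k := by exact_mod_cast (by omega : n ≤ 4 * k)
    have h2 : (n : ℝ) ^ 2 ≤ (4 * k) ^ 2 := pow_le_pow_left₀ (by positivity) h1 2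
    nlinarith
  have hC : ENNReal.ofReal (δ / 16 * (n : ℝ) ^ 2) ≤
      (randomizedCommunicationComplexity q (decisionProblem R) : ℝ≥0∞) :=
    ofReal_le_randomizedComplexity fun P hP c hc => hkn.trans
      (hbound k (by omega) id (decisionProblem R) φ ψ hf P hP c hc)
  have hQ : ENNReal.ofReal (δ / 16 * (n : ℝ) ^ 2) ≤
      (randomizedQueryComplexity q (decisionProblem R) : ℝ≥0∞) :=
    ofReal_le_randomizedComplexity fun P hP c hc => hkn.trans
      (hbound k (by omega) QueryAlgorithm.toProtocol (decisionProblem R) φ ψ hf P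
        (by simpa only [QueryAlgorithm.run_toProtocol] using hP) c
        (by simpa only [QueryAlgorithm.bits_toProtocol] using hc))
  exact ⟨hC, hC.trans (ENat.toENNReal_le.2
      (randomizedComplexity_le_deterministicComplexity _ _ hq1 _)),
    hQ, hQ.trans (ENat.toENNReal_le.2
      (randomizedComplexity_le_deterministicComplexity _ _ hq1 _))⟩
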